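/- Let $n\ge 1$ and let $\mathbb{T}^n=\mathbb{R}^n/\mathbb{Z}^n$ be the flat torus. A *medium* is a countably additive set function $\theta$ on the Borel subsets of $\mathbb{T}^n$ with values in the positive semidefinite matrices of $\mathbb{R}^{n\times n}$. Write $\|\theta\|(E)=\operatorname{tr}\theta(E)$ for its mass measure, $\sigma=d\theta/d\|\theta\|$ for its density, and $\operatorname{spt}\theta$ for the support of $\|\theta\|$ (the complement of the largest open $\|\theta\|$-null set). The *effective tensor* $Q(\theta)\in\mathbb{R}^{n\times n}$ is the positive semidefinite matrix determined by $$p\cdot Q(\theta)p=\inf_{\varphi\in C^\infty(\mathbb{T}^n)}\int_{\mathbb{T}^n}(\nabla\varphi+p)\cdot\sigma(\nabla\varphi+p)\,d\|\theta\|\qquad\text{for all }p\in\mathbb{R}^n .$$ For a Borel set $E$, the restriction $\theta|_E$ is the medium $A\mapsto\theta(E\cap A)$. A set $E\subset\mathbb{T}^n$ is *1-rectifiable* if there are countably many Lipschitz maps $f_i:\mathbb{R}\to\mathbb{T}^n$ with $\mathcal{H}^1\big(E\setminus\bigcup_i f_i(\mathbb{R})\big)=0$, where $\mathcal{H}^1$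 is the 1-dimensional Hausdorff measure. **Theorem.** Let $\theta$ be a medium that is nontrivial, i.e. $Q(\theta)\neq 0$, and suppose $\mathcal{H}^1(\operatorname{spt}\theta)<\infty$. Then there is a countable (finite or countably infinite) family of mutually disjoint connected components $E_i$ of $\operatorname{spt}\theta$, each of them 1-rectifiable, such that $$Q(\theta)=\sum_i Q(\theta|_{E_i}),$$ the sum being convergent (in any order). -/

import Mathlib

open MeasureTheory Set
open scoped ContDiff Matrix NNReal ENNReal

noncomputable section

/-! ### The flat torus -/

/-- The integer lattice `ℤⁿ` in Euclidean space `ℝⁿ`. -/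
def integerLattice (n : ℕ) : AddSubgroup (EuclideanSpace ℝ (Fin n)) where
  carrier := {x | ∀ i, ∃ k : ℤ, (k : ℝ) = x i}
  zero_mem' := fun _ => ⟨0, by simp⟩
  add_mem' := by
    intro a b ha hb i
    obtain ⟨k, hk⟩ := ha i
    obtain ⟨l, hl⟩ := hb i
    exact ⟨k + l, by simp [hk, hl]⟩
  neg_mem' := by
    intro a ha i
    obtain ⟨k, hk⟩ := ha i
    exact ⟨-k, by simp [hk]⟩

instance integerLattice_isClosed (n : ℕ) :
    IsClosed (integerLattice n : Set (EuclideanSpace ℝ (Fin n))) := by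
  have h : (integerLattice n : Set (EuclideanSpace ℝ (Fin n))) =
      ⋂ i : Fin n, (fun x : EuclideanSpace ℝ (Fin n) => x i) ⁻¹' (range ((↑) : ℤ → ℝ)) := by
    ext x
    simp [integerLattice]
  rw [h]
  exact isClosed_iInter fun i =>
    (Int.isClosedEmbedding_coe_real.isClosed_range).preimage (by fun_prop)

/-- The flat torus `𝕋ⁿ = ℝⁿ / ℤⁿ`. It carries the quotient norm, whose distance is the flat
distance `d([x], [y]) = inf_{k ∈ ℤⁿ} |x - y + k|`, and its Borel σ-algebra. -/
abbrev Torus (n : ℕ) : Type := EuclideanSpace ℝ (Fin n) ⧸ integerLattice n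

namespace Torus

/-- The projection `π : ℝⁿ → 𝕋ⁿ`. -/
def proj {n : ℕ} (y : EuclideanSpace ℝ (Fin n)) : Torus n := QuotientAddGroup.mk y

theorem continuous_proj {n : ℕ} : Continuous (proj : EuclideanSpace ℝ (Fin n) → Torus n) :=
  QuotientAddGroup.continuous_mk

/-- The space `C^∞(𝕋ⁿ)` of smooth real functions on the torus: those whose periodic lift to `ℝⁿ`
is smooth. -/
def smoothFunctions (n : ℕ) : Submodule ℝ (Torus n → ℝ) where
  carrier := {φ | ContDiff ℝ ∞ (φ ∘ (proj : EuclideanSpace ℝ (Fin n) → Torus n))}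
  zero_mem' := (contDiff_const : ContDiff ℝ ∞ fun _ : EuclideanSpace ℝ (Fin n) => (0 : ℝ))
  add_mem' := fun {a b} (ha : ContDiff ℝ ∞ (a ∘ proj)) (hb : ContDiff ℝ ∞ (b ∘ proj)) =>
    ContDiff.add ha hb
  smul_mem' := fun c a (ha : ContDiff ℝ ∞ (a ∘ proj)) => ContDiff.const_smul c ha

/-- The gradient of a function on the torus, computed on its periodic lift at any
representative of the point (see `grad_proj`). -/
def grad {n : ℕ} (φ : Torus n → ℝ) (x : Torus n) : EuclideanSpace ℝ (Fin n) :=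
  gradient (φ ∘ proj) (Quotient.out x)

theorem grad_proj {n : ℕ} (φ : Torus n → ℝ) (y : EuclideanSpace ℝ (Fin n)) :
    grad φ (proj y) = gradient (φ ∘ proj) y := by
  have hout : (proj (Quotient.out (proj y)) : Torus n) = proj y := Quotient.out_eq _
  set z : EuclideanSpace ℝ (Fin n) := Quotient.out (proj y) with hz
  have hper : (fun w => (φ ∘ (proj : _ → Torus n)) (w + (y - z))) = φ ∘ proj := by
    funext w
    have h1 : (proj (y - z) : Torus n) = 0 := by
      have : (proj (y - z) : Torus n) = proj y - proj z := rfl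
      rw [this, hout, sub_self]
    have h2 : (proj (w + (y - z)) : Torus n) = proj w := by
      have : (proj (w + (y - z)) : Torus n) = proj w + proj (y - z) := rfl
      rw [this, h1, add_zero]
    simp [Function.comp, h2]
  have hf : fderiv ℝ (φ ∘ (proj : _ → Torus n)) z = fderiv ℝ (φ ∘ proj) y := by
    have h3 := fderiv_comp_add_right (𝕜 := ℝ) (f := φ ∘ (proj : _ → Torus n)) (x := z) (y - z)
    rw [hper] at h3
    rw [h3]
    congr 1
    abel
  simp only [grad, gradient]
  rw [← hz, hf]

theorem continuous_grad {n : ℕ} (φ : smoothFunctions n) : Continuous (grad (φ : Torus n → ℝ)) := by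
  have hq : Topology.IsQuotientMap (proj : EuclideanSpace ℝ (Fin n) → Torus n) :=
    isQuotientMap_quotient_mk'
  rw [hq.continuous_iff]
  have h : (grad (φ : Torus n → ℝ)) ∘ proj = gradient ((φ : Torus n → ℝ) ∘ proj) := by
    funext y
    exact grad_proj _ y
  rw [h]
  have hφ : ContDiff ℝ ∞ ((φ : Torus n → ℝ) ∘ (proj : EuclideanSpace ℝ (Fin n) → Torus n)) :=
    φ.2
  have hc := hφ.continuous_fderiv (by simp)
  exact (LinearIsometryEquiv.continuous _).comp hc

theorem grad_add {n : ℕ} (φ ψ : smoothFunctions n) (x : Torus n) :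
    grad ((φ + ψ : smoothFunctions n) : Torus n → ℝ) x = grad φ.1 x + grad ψ.1 x := by
  have h1 : DifferentiableAt ℝ (φ.1 ∘ proj) (Quotient.out x) :=
    (ContDiff.differentiable (n := ∞) φ.2 (by simp)).differentiableAt
  have h2 : DifferentiableAt ℝ (ψ.1 ∘ proj) (Quotient.out x) :=
    (ContDiff.differentiable (n := ∞) ψ.2 (by simp)).differentiableAt
  have h3 : (((φ + ψ : smoothFunctions n) : Torus n → ℝ) ∘ proj) = φ.1 ∘ proj + ψ.1 ∘ proj := rfl
  simp only [grad, gradient]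
  rw [h3, fderiv_add h1 h2, map_add]

theorem grad_smul {n : ℕ} (c : ℝ) (φ : smoothFunctions n) (x : Torus n) :
    grad ((c • φ : smoothFunctions n) : Torus n → ℝ) x = c • grad φ.1 x := by
  have h1 : DifferentiableAt ℝ (φ.1 ∘ proj) (Quotient.out x) :=
    (ContDiff.differentiable (n := ∞) φ.2 (by simp)).differentiableAt
  have h3 : (((c • φ : smoothFunctions n) : Torus n → ℝ) ∘ proj) = c • (φ.1 ∘ proj) := rfl
  simp only [grad, gradient]
  rw [h3, fderiv_const_smul h1, map_smul]

instance compactSpace (n : ℕ) : CompactSpace (Torus n) := by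
  let K : Set (EuclideanSpace ℝ (Fin n)) :=
    (WithLp.toLp 2) '' (Set.pi univ fun _ : Fin n => Icc (0 : ℝ) 1)
  have hK : IsCompact K :=
    (isCompact_univ_pi fun _ => isCompact_Icc).image (PiLp.continuous_toLp 2 _)
  refine ⟨?_⟩
  have : (univ : Set (Torus n)) = proj '' K := by
    symm
    rw [eq_univ_iff_forall]
    intro x
    obtain ⟨y, rfl⟩ := QuotientAddGroup.mk_surjective x
    refine ⟨WithLp.toLp 2 fun i => Int.fract (y i), ⟨_, ?_, rfl⟩, ?_⟩
    · intro i _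
      exact ⟨Int.fract_nonneg _, (Int.fract_lt_one _).le⟩
    · refine QuotientAddGroup.eq.2 ?_
      intro i
      exact ⟨⌊y i⌋, by simp [← Int.self_sub_fract]; ring⟩
  rw [this]
  exact hK.image continuous_proj

end Torus

/-! ### Conductive media -/

/-- A conductive medium on `𝕋ⁿ`: a countably additive set function on the Borel sets with values
in the positive semidefinite `n × n` real matrices. (The trace is then a finite Borel measure on a
compact metric space, hence a Radon measure. Vector measures vanish on non-Borel sets by
convention.) -/
structure Medium (n : ℕ) where
  /-- the underlying matrix-valued measure -/
  toVectorMeasure : VectorMeasure (Torus n) (Matrix (Fin n) (Fin n) ℝ)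
  /-- its values are positive semidefinite -/
  posSemidef : ∀ E : Set (Torus n), MeasurableSet E → (toVectorMeasure E).PosSemidef

namespace Medium

variable {n : ℕ}

/-- The signed measure `E ↦ tr θ(E)`. -/
def traceMeasure (θ : Medium n) : SignedMeasure (Torus n) :=
  θ.toVectorMeasure.mapRange (Matrix.traceAddMonoidHom (Fin n) ℝ)
    (continuous_id.matrix_trace)

theorem traceMeasure_nonneg (θ : Medium n) : 0 ≤[univ] θ.traceMeasure := by
  refine VectorMeasure.restrict_le_restrict_of_subset_le _ _ fun j hj _ => ?_
  exact (θ.posSemidef j hj).trace_nonneg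

/-- The mass distribution `‖θ‖(E) = tr θ(E)` of a medium, as a measure. -/
def mass (θ : Medium n) : Measure (Torus n) :=
  θ.traceMeasure.toMeasureOfZeroLE univ MeasurableSet.univ θ.traceMeasure_nonneg

instance isFiniteMeasure_mass (θ : Medium n) : IsFiniteMeasure θ.mass :=
  SignedMeasure.toMeasureOfZeroLE_finite _ _ _

theorem mass_real_apply (θ : Medium n) {E : Set (Torus n)} (hE : MeasurableSet E) :
    θ.mass.real E = (θ.toVectorMeasure E).trace := by
  rw [mass, SignedMeasure.toMeasureOfZeroLE_real_apply _ _ _ hE, univ_inter]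
  rfl

/-- The support of a medium: the complement of the largest open set of zero mass. -/
def support (θ : Medium n) : Set (Torus n) := θ.mass.support

/-- The signed measure `E ↦ θ(E)ᵢⱼ`. -/
def entry (θ : Medium n) (i j : Fin n) : SignedMeasure (Torus n) :=
  θ.toVectorMeasure.mapRange (Matrix.entryAddMonoidHom ℝ i j) (continuous_id.matrix_elem i j)

/-- The matrix field `σ = dθ / d‖θ‖` (entrywise Radon–Nikodym derivative). -/
def density (θ : Medium n) (x : Torus n) : Matrix (Fin n) (Fin n) ℝ :=
  Matrix.of fun i j => (θ.entry i j).rnDeriv θ.mass x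

/-- The restriction `θ_E(A) = θ(E ∩ A)` of a medium to a Borel set `E`. -/
def restrict (θ : Medium n) (E : Set (Torus n)) : Medium n where
  toVectorMeasure := θ.toVectorMeasure.restrict E
  posSemidef := by
    intro A hA
    by_cases hE : MeasurableSet E
    · rw [VectorMeasure.restrict_apply _ hE hA]
      exact θ.posSemidef _ (hA.inter hE)
    · rw [VectorMeasure.restrict_not_measurable _ hE]
      exact Matrix.PosSemidef.zero

/-- The energy `∫ (∇φ + p) · σ (∇φ + p) d‖θ‖`. -/
def energy (θ : Medium n) (φ : Torus n → ℝ) (p : EuclideanSpace ℝ (Fin n)) : ℝ :=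
  ∫ x, (Torus.grad φ x + p).ofLp ⬝ᵥ (θ.density x *ᵥ (Torus.grad φ x + p).ofLp) ∂θ.mass

/-- The effective energy `q(p) = inf_{φ ∈ C^∞(𝕋ⁿ)} ∫ (∇φ + p) · σ (∇φ + p) d‖θ‖`. -/
def effectiveEnergy (θ : Medium n) (p : EuclideanSpace ℝ (Fin n)) : ℝ :=
  ⨅ φ : Torus.smoothFunctions n, θ.energy φ p

/-- The effective conductance tensor `Q(θ)`: the symmetric matrix of the quadratic form
`effectiveEnergy`, written by polarization. It is characterized by the two facts
`effectiveTensor_posSemidef` and `effectiveTensor_spec` below. -/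
def effectiveTensor (θ : Medium n) : Matrix (Fin n) (Fin n) ℝ :=
  Matrix.of fun i j =>
    (θ.effectiveEnergy (EuclideanSpace.single i 1 + EuclideanSpace.single j 1)
      - θ.effectiveEnergy (EuclideanSpace.single i 1)
      - θ.effectiveEnergy (EuclideanSpace.single j 1)) / 2

/-! The effective tensor really is the positive semidefinite matrix with
`p · Q(θ) p = inf_φ ∫ (∇φ + p) · σ (∇φ + p) d‖θ‖` for all `p`. -/

theorem withDensity_density (θ : Medium n) (i j : Fin n) :
    θ.mass.withDensityᵥ (fun x => θ.density x i j) = θ.entry i j := by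
  refine SignedMeasure.withDensityᵥ_rnDeriv_eq _ _ ?_
  refine VectorMeasure.AbsolutelyContinuous.mk fun A hA h => ?_
  rw [Measure.toENNRealVectorMeasure_apply_measurable hA] at h
  have h1 : (θ.toVectorMeasure A).trace = 0 := by
    rw [← θ.mass_real_apply hA, measureReal_def, h]; simp
  have h2 := (θ.posSemidef A hA).trace_eq_zero_iff.1 h1
  change θ.toVectorMeasure A i j = 0
  rw [h2]; rfl

theorem integrable_density (θ : Medium n) (i j : Fin n) :
    Integrable (fun x => θ.density x i j) θ.mass :=
  SignedMeasure.integrable_rnDeriv _ _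

theorem setIntegral_density (θ : Medium n) (i j : Fin n) {A : Set (Torus n)}
    (hA : MeasurableSet A) : ∫ x in A, θ.density x i j ∂θ.mass = θ.toVectorMeasure A i j := by
  rw [← withDensityᵥ_apply (θ.integrable_density i j) hA, θ.withDensity_density]
  rfl

theorem density_symm (θ : Medium n) (x : Torus n) (i j : Fin n) :
    θ.density x i j = θ.density x j i := by
  have h : θ.entry i j = θ.entry j i := by
    ext A hA
    exact (congrFun (congrFun (θ.posSemidef A hA).1 i) j).symm
  simp [density, h]

theorem ae_density_nonneg (θ : Medium n) :
    ∀ᵐ x ∂θ.mass, ∀ v : Fin n → ℝ, 0 ≤ v ⬝ᵥ (θ.density x *ᵥ v) := by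
  have key : ∀ v : Fin n → ℝ, ∀ᵐ x ∂θ.mass, 0 ≤ v ⬝ᵥ (θ.density x *ᵥ v) := by
    intro v
    have hint : ∀ i j, Integrable (fun x => v i * (θ.density x i j * v j)) θ.mass := fun i j =>
      ((θ.integrable_density i j).mul_const _).const_mul _
    have he : (fun x => v ⬝ᵥ (θ.density x *ᵥ v)) =
        fun x => ∑ i, ∑ j, v i * (θ.density x i j * v j) := by
      funext x
      simp [dotProduct, Matrix.mulVec, Finset.mul_sum]
    refine ae_nonneg_of_forall_setIntegral_nonneg ?_ ?_
    · rw [he]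
      exact integrable_finsetSum _ fun i _ => integrable_finsetSum _ fun j _ => hint i j
    · intro A hA _
      have : ∫ x in A, v ⬝ᵥ (θ.density x *ᵥ v) ∂θ.mass = v ⬝ᵥ (θ.toVectorMeasure A *ᵥ v) := by
        simp only [congrFun he]
        rw [integral_finsetSum _ fun i _ =>
          integrable_finsetSum _ fun j _ => (hint i j).integrableOn]
        simp only [dotProduct, Matrix.mulVec, Finset.mul_sum]
        refine Finset.sum_congr rfl fun i _ => ?_
        rw [integral_finsetSum _ fun j _ => (hint i j).integrableOn]
        refine Finset.sum_congr rfl fun j _ => ?_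
        rw [integral_const_mul, integral_mul_const, θ.setIntegral_density i j hA]
      rw [this]
      simpa using (θ.posSemidef A hA).dotProduct_mulVec_nonneg v
  have h2 : ∀ᵐ x ∂θ.mass, ∀ k : ℕ, 0 ≤ (TopologicalSpace.denseSeq (Fin n → ℝ) k) ⬝ᵥ
      (θ.density x *ᵥ (TopologicalSpace.denseSeq (Fin n → ℝ) k)) := ae_all_iff.2 fun k => key _
  filter_upwards [h2] with x hx v
  have hcl : IsClosed {w : Fin n → ℝ | 0 ≤ w ⬝ᵥ (θ.density x *ᵥ w)} :=
    isClosed_le continuous_const (by fun_prop)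
  have := (TopologicalSpace.denseRange_denseSeq (Fin n → ℝ)).closure_eq
  have hsub : closure (range (TopologicalSpace.denseSeq (Fin n → ℝ))) ⊆
      {w : Fin n → ℝ | 0 ≤ w ⬝ᵥ (θ.density x *ᵥ w)} :=
    closure_minimal (by rintro _ ⟨k, rfl⟩; exact hx k) hcl
  rw [this] at hsub
  exact hsub (mem_univ v)

/-- The field `∇φ + p` attached to a pair `(φ, p)`. -/
def field (z : Torus.smoothFunctions n × EuclideanSpace ℝ (Fin n)) (x : Torus n) : Fin n → ℝ :=
  (Torus.grad z.1.1 x + z.2).ofLp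

theorem continuous_field (z : Torus.smoothFunctions n × EuclideanSpace ℝ (Fin n)) :
    Continuous (field z) :=
  (PiLp.continuous_ofLp 2 _).comp ((Torus.continuous_grad z.1).add continuous_const)

theorem field_add (z w : Torus.smoothFunctions n × EuclideanSpace ℝ (Fin n)) (x : Torus n) :
    field (z + w) x = field z x + field w x := by
  have := Torus.grad_add z.1 w.1 x
  simp only [field, Prod.fst_add, Prod.snd_add]
  rw [this]
  ext i
  simp only [PiLp.add_apply, Pi.add_apply]
  ring

theorem field_smul (c : ℝ) (z : Torus.smoothFunctions n × EuclideanSpace ℝ (Fin n))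
    (x : Torus n) : field (c • z) x = c • field z x := by
  have := Torus.grad_smul c z.1 x
  simp only [field, Prod.smul_fst, Prod.smul_snd]
  rw [this]
  ext i
  simp only [PiLp.add_apply, PiLp.smul_apply, Pi.smul_apply, smul_eq_mul]
  ring

theorem integrable_energy (θ : Medium n)
    (z w : Torus.smoothFunctions n × EuclideanSpace ℝ (Fin n)) :
    Integrable (fun x => field z x ⬝ᵥ (θ.density x *ᵥ field w x)) θ.mass := by
  have he : (fun x => field z x ⬝ᵥ (θ.density x *ᵥ field w x)) =
      fun x => ∑ i, ∑ j, (field z x i * field w x j) * θ.density x i j := by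
    funext x
    simp only [dotProduct, Matrix.mulVec, Finset.mul_sum]
    refine Finset.sum_congr rfl fun i _ => Finset.sum_congr rfl fun j _ => ?_
    ring
  rw [he]
  refine integrable_finsetSum _ fun i _ => integrable_finsetSum _ fun j _ => ?_
  have hc : Continuous fun x => field z x i * field w x j :=
    ((continuous_apply i).comp (continuous_field z)).mul
      ((continuous_apply j).comp (continuous_field w))
  obtain ⟨C, hC⟩ := isCompact_univ.exists_bound_of_continuousOn hc.continuousOn
  exact (θ.integrable_density i j).bdd_mul hc.aestronglyMeasurable
    (Filter.Eventually.of_forall fun x => hC x (mem_univ x))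

/-- The symmetric bilinear form whose quadratic form is the energy. -/
def energyForm (θ : Medium n) :
    LinearMap.BilinForm ℝ (Torus.smoothFunctions n × EuclideanSpace ℝ (Fin n)) :=
  LinearMap.mk₂ ℝ (fun z w => ∫ x, field z x ⬝ᵥ (θ.density x *ᵥ field w x) ∂θ.mass)
    (by
      intro z z' w
      rw [← integral_add (θ.integrable_energy z w) (θ.integrable_energy z' w)]
      simp only [field_add, add_dotProduct])
    (by
      intro c z w
      rw [smul_eq_mul, ← integral_const_mul]
      simp only [field_smul, smul_dotProduct, smul_eq_mul])
    (by
      intro z w w'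
      rw [← integral_add (θ.integrable_energy z w) (θ.integrable_energy z w')]
      simp only [field_add, Matrix.mulVec_add, dotProduct_add])
    (by
      intro c z w
      rw [smul_eq_mul, ← integral_const_mul]
      simp only [field_smul, Matrix.mulVec_smul, dotProduct_smul, smul_eq_mul])

theorem energyForm_symm (θ : Medium n)
    (z w : Torus.smoothFunctions n × EuclideanSpace ℝ (Fin n)) :
    θ.energyForm z w = θ.energyForm w z := by
  simp only [energyForm, LinearMap.mk₂_apply]
  congr 1
  funext x
  have hs : (θ.density x)ᵀ = θ.density x := by
    ext i j
    exact θ.density_symm x j i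
  rw [Matrix.dotProduct_mulVec, ← Matrix.mulVec_transpose, hs, dotProduct_comm]

theorem energyForm_nonneg (θ : Medium n)
    (z : Torus.smoothFunctions n × EuclideanSpace ℝ (Fin n)) : 0 ≤ θ.energyForm z z := by
  simp only [energyForm, LinearMap.mk₂_apply]
  refine integral_nonneg_of_ae ?_
  filter_upwards [θ.ae_density_nonneg] with x hx
  exact hx _

/-- Partially minimizing a positive semidefinite quadratic form gives a quadratic form. -/
theorem exists_bilinForm_iInf {S P : Type*} [AddCommGroup S] [Module ℝ S] [AddCommGroup P]
    [Module ℝ P] (B : LinearMap.BilinForm ℝ (S × P)) (hs : ∀ x y, B x y = B y x)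
    (hp : ∀ x, 0 ≤ B x x) :
    ∃ b : LinearMap.BilinForm ℝ P, (∀ p r, b p r = b r p) ∧
      ∀ p, b p p = ⨅ φ : S, B (φ, p) (φ, p) := by
  let core : PreInnerProductSpace.Core ℝ (S × P) :=
    { inner := fun x y => B x y
      conj_inner_symm := fun x y => by simpa using hs y x
      re_inner_nonneg := fun x => by simpa using hp x
      add_left := fun x y z => by simp
      smul_left := fun x y r => by simp }
  let V := S × P
  let _ : SeminormedAddCommGroup V :=
    InnerProductSpace.Core.toSeminormedAddCommGroup (𝕜 := ℝ) (F := S × P)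
  let _ : InnerProductSpace ℝ V := InnerProductSpace.ofCore core
  have hinner : ∀ x y : V, inner ℝ x y = B x y := fun x y => rfl
  have hnorm : ∀ x : V, ‖x‖ ^ 2 = B x x := fun x => by
    rw [← real_inner_self_eq_norm_sq, hinner]
  let T : V →ₗᵢ[ℝ] UniformSpace.Completion V := UniformSpace.Completion.toComplₗᵢ
  let L : S →ₗ[ℝ] UniformSpace.Completion V := T.toLinearMap.comp (LinearMap.inl ℝ S P)
  let K : Submodule ℝ (UniformSpace.Completion V) := (LinearMap.range L).topologicalClosure
  have : CompleteSpace K := (LinearMap.range L).isClosed_topologicalClosure.completeSpace_coe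
  let N : P →ₗ[ℝ] UniformSpace.Completion V :=
    (LinearMap.id - K.starProjection.toLinearMap).comp
      (T.toLinearMap.comp (LinearMap.inr ℝ S P))
  refine ⟨(innerₗ (UniformSpace.Completion V)).compl₁₂ N N, fun p r => ?_, fun p => ?_⟩
  · simp only [LinearMap.compl₁₂_apply, innerₗ_apply_apply]
    exact real_inner_comm _ _
  have hN : N p = T ((0, p) : S × P) - K.starProjection (T ((0, p) : S × P)) := rfl
  have hb : ((innerₗ (UniformSpace.Completion V)).compl₁₂ N N) p p = ‖N p‖ ^ 2 := by
    simp only [LinearMap.compl₁₂_apply, innerₗ_apply_apply]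
    exact real_inner_self_eq_norm_sq _
  have hsub : ∀ φ : S, T ((0, p) : S × P) - L φ = T ((-φ, p) : S × P) := by
    intro φ
    change T ((0, p) : S × P) - T ((φ, 0) : S × P) = _
    rw [← map_sub]
    congr 1
    exact Prod.ext (zero_sub φ) (sub_zero p)
  have hbdd : BddBelow (range fun φ : S => B (φ, p) (φ, p)) :=
    ⟨0, by rintro _ ⟨φ, rfl⟩; exact hp _⟩
  rw [hb]
  refine le_antisymm (le_ciInf fun φ => ?_) ?_
  · have h1 : ‖N p‖ ≤ ‖T ((0, p) : S × P) - L (-φ)‖ := by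
      rw [hN, Submodule.starProjection_minimal]
      exact ciInf_le (f := fun x : K => ‖T ((0, p) : S × P) - x‖)
        ⟨0, by rintro _ ⟨x, rfl⟩; exact norm_nonneg _⟩
        ⟨L (-φ), (LinearMap.range L).le_topologicalClosure ⟨-φ, rfl⟩⟩
    rw [hsub, neg_neg, T.norm_map] at h1
    rw [← hnorm]
    exact pow_le_pow_left₀ (norm_nonneg _) h1 2
  · have hle : ∀ ε : ℝ, 0 < ε → (⨅ φ : S, B (φ, p) (φ, p)) ≤ (‖N p‖ + ε) ^ 2 := by
      intro ε hε
      have hmem : K.starProjection (T ((0, p) : S × P)) ∈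
          closure (LinearMap.range L : Set (UniformSpace.Completion V)) :=
        K.starProjection_apply_mem _
      obtain ⟨_, ⟨φ, rfl⟩, hφ⟩ := Metric.mem_closure_iff.1 hmem ε hε
      have h2 : ‖T ((0, p) : S × P) - L φ‖ ≤ ‖N p‖ + ε := by
        calc ‖T ((0, p) : S × P) - L φ‖
            = ‖N p + (K.starProjection (T ((0, p) : S × P)) - L φ)‖ := by
              rw [hN]; congr 1; abel
          _ ≤ ‖N p‖ + ‖K.starProjection (T ((0, p) : S × P)) - L φ‖ := norm_add_le _ _
          _ ≤ ‖N p‖ + ε := by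
              rw [← dist_eq_norm]
              exact add_le_add le_rfl hφ.le
      rw [hsub, T.norm_map] at h2
      refine (ciInf_le hbdd (-φ)).trans ?_
      rw [← hnorm]
      exact pow_le_pow_left₀ (norm_nonneg _) h2 2
    have hlim : Filter.Tendsto (fun ε : ℝ => (‖N p‖ + ε) ^ 2) (nhdsWithin 0 (Ioi 0))
        (nhds (‖N p‖ ^ 2)) := by
      have hc : Continuous fun ε : ℝ => (‖N p‖ + ε) ^ 2 := by fun_prop
      have := hc.tendsto 0
      rw [add_zero] at this
      exact this.mono_left nhdsWithin_le_nhds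
    exact ge_of_tendsto hlim (by filter_upwards [self_mem_nhdsWithin] with ε hε using hle ε hε)

theorem exists_effectiveForm (θ : Medium n) :
    ∃ b : LinearMap.BilinForm ℝ (EuclideanSpace ℝ (Fin n)), (∀ p r, b p r = b r p) ∧
      ∀ p, b p p = θ.effectiveEnergy p :=
  exists_bilinForm_iInf θ.energyForm θ.energyForm_symm θ.energyForm_nonneg

theorem effectiveEnergy_nonneg (θ : Medium n) (p : EuclideanSpace ℝ (Fin n)) :
    0 ≤ θ.effectiveEnergy p :=
  Real.iInf_nonneg fun φ => θ.energyForm_nonneg (φ, p)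

/-- The defining property of the effective tensor. -/
theorem effectiveTensor_spec (θ : Medium n) (p : EuclideanSpace ℝ (Fin n)) :
    p.ofLp ⬝ᵥ (θ.effectiveTensor *ᵥ p.ofLp) =
      ⨅ φ : Torus.smoothFunctions n, θ.energy φ p := by
  obtain ⟨b, hsymm, hb⟩ := θ.exists_effectiveForm
  have hentry : ∀ i j, θ.effectiveTensor i j =
      b (EuclideanSpace.single i 1) (EuclideanSpace.single j 1) := by
    intro i j
    simp only [effectiveTensor, Matrix.of_apply, ← hb, map_add, LinearMap.add_apply]
    rw [hsymm (EuclideanSpace.single j 1) (EuclideanSpace.single i 1)]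
    ring
  change _ = θ.effectiveEnergy p
  rw [← hb]
  have hsum : p = ∑ i, p i • (EuclideanSpace.single i (1 : ℝ) : EuclideanSpace ℝ (Fin n)) := by
    ext k
    simp [Pi.single_apply]
  conv_rhs => rw [hsum]
  simp only [map_sum, LinearMap.sum_apply, map_smul, LinearMap.smul_apply, smul_eq_mul,
    dotProduct, Matrix.mulVec, hentry, Finset.mul_sum]
  rw [Finset.sum_comm]
  refine Finset.sum_congr rfl fun i _ => Finset.sum_congr rfl fun j _ => ?_
  ring

theorem effectiveTensor_posSemidef (θ : Medium n) : θ.effectiveTensor.PosSemidef := by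
  refine Matrix.PosSemidef.of_dotProduct_mulVec_nonneg ?_ fun v => ?_
  · ext i j
    simp only [Matrix.conjTranspose_apply, star_trivial, effectiveTensor, Matrix.of_apply]
    rw [add_comm]
    ring
  · have h := θ.effectiveTensor_spec (WithLp.toLp 2 v)
    have h0 := θ.effectiveEnergy_nonneg (WithLp.toLp 2 v)
    simp only [star_trivial]
    exact h0.trans_eq h.symm

/-- A medium is nontrivial if its effective tensor does not vanish. -/
def Nontrivial (θ : Medium n) : Prop := θ.effectiveTensor ≠ 0

end Medium

/-! ### Rectifiable sets and connected components -/

/-- A set `E` in a metric space is `k`-rectifiable if countably many Lipschitz images of `ℝᵏ`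
cover it up to a set of zero `k`-dimensional Hausdorff measure. -/
def IsRectifiable {X : Type*} [MetricSpace X] [MeasurableSpace X] [BorelSpace X]
    (k : ℕ) (E : Set X) : Prop :=
  ∃ f : ℕ → EuclideanSpace ℝ (Fin k) → X, (∀ i, ∃ C : ℝ≥0, LipschitzWith C (f i)) ∧
    μH[(k : ℝ)] (E \ ⋃ i, range (f i)) = 0

/-- `E` is a connected component of the subset `S`. -/
def IsComponentOf {X : Type*} [TopologicalSpace X] (E S : Set X) : Prop :=
  ∃ x ∈ S, E = connectedComponentIn S x

end

/-!
The point of the proof is that a medium contained in a small ball does not conduct: there is a smooth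
function of the torus whose gradient on the ball is `-p`, and it cancels the field `p`
(`Medium.effectiveEnergy_restrict_eq_zero`). Hence only the components of the support of length at
least `1 / 8` matter. There are finitely many of them, since they are disjoint and the support has
finite length; a connected set of smaller length lies in a ball of radius `1 / 8`, because distance
functions map it onto intervals. So the family of components is in fact finite.

The effective energy is superadditive over these components because the energy integrand is
nonnegative (`Medium.sum_effectiveEnergy_restrict_le`). For the opposite inequality
(`Medium.effectiveEnergy_le_sum`), each component of the compact support is the intersection of its
relatively clopen neighbourhoods. By compactness the support is covered by one relatively clopen
set around each large component, whose energy exceeds that of the component by at most `ε`, and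
finitely many more relatively clopen sets inside small balls, which have energy zero. Test functions
on disjoint closed sets can be glued (`Torus.exists_grad_eq_on`), so the effective energy is
subadditive over such a cover. The smooth cut-off functions needed for the gluing come from the
Stone-Weierstrass theorem on the torus.

The components are rectifiable because a continuum of finite length is the image of a Lipschitz
curve (`exists_lipschitz_surjective`). A maximal `ε`-separated subset has at most `C / ε` points,
these form a connected graph when points at distance at most `2 * ε` are joined, and a closed walk
through all the vertices is a discrete path of bounded speed and bounded duration. An ultrafilter
limit of these paths as `ε → 0` is the required curve.
-/

/-! ### Continua of finite length are Lipschitz curves -/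

/-- A connected set has length at least `r` inside a ball of radius `r` centred on it, unless the
ball contains the whole set: the distance to the centre maps it onto an interval. -/
theorem IsPreconnected.ofReal_le_hausdorffMeasure_inter_ball {X : Type*} [MetricSpace X]
    [MeasurableSpace X] [BorelSpace X] {C : Set X} (hC : IsPreconnected C) {x y : X} (hx : x ∈ C)
    (hy : y ∈ C) {r : ℝ} (hr : r ≤ dist y x) :
    ENNReal.ofReal r ≤ μH[1] (C ∩ Metric.ball x r) := by
  have hf : LipschitzWith 1 (fun z : X => dist z x) := LipschitzWith.dist_left x
  have hsub : Ico 0 r ⊆ (fun z : X => dist z x) '' (C ∩ Metric.ball x r) := by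
    intro t ht
    obtain ⟨z, hz, hzt⟩ := hC.intermediate_value hx hy hf.continuous.continuousOn
      (show t ∈ Icc (dist x x) (dist y x) from ⟨by simpa using ht.1, ht.2.le.trans hr⟩)
    exact ⟨z, ⟨hz, by simpa [Metric.mem_ball, ← hzt] using ht.2⟩, hzt⟩
  calc ENNReal.ofReal r = volume (Ico 0 r) := by simp
    _ ≤ volume ((fun z : X => dist z x) '' (C ∩ Metric.ball x r)) := measure_mono hsub
    _ = μH[1] ((fun z : X => dist z x) '' (C ∩ Metric.ball x r)) := by rw [hausdorffMeasure_real]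
    _ ≤ μH[1] (C ∩ Metric.ball x r) := by
      simpa using hf.hausdorffMeasure_image_le zero_le_one (C ∩ Metric.ball x r)

/-- A finite connected graph with `N` vertices has a closed walk of length at most `2 * N` through
all vertices: as long as a vertex is missed, insert a detour back and forth along an edge that
leaves the set of visited vertices. -/
theorem SimpleGraph.Connected.exists_covering_walk {V : Type*} [Fintype V]
    {G : SimpleGraph V} (hG : G.Connected) (v : V) :
    ∃ w : G.Walk v v, (∀ u, u ∈ w.support) ∧ w.length ≤ 2 * Fintype.card V := by
  classical
  have key : ∀ k : ℕ, ∃ w : G.Walk v v, w.length ≤ 2 * k ∧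
      ((∀ u, u ∈ w.support) ∨ k + 1 ≤ w.support.toFinset.card) := by
    intro k
    induction k with
    | zero => exact ⟨.nil, by simp, Or.inr (by simp)⟩
    | succ k ih =>
      obtain ⟨w, hw, h | h⟩ := ih
      · exact ⟨w, by omega, Or.inl h⟩
      by_cases hall : ∀ u, u ∈ w.support
      · exact ⟨w, by omega, Or.inl hall⟩
      push Not at hall
      obtain ⟨u, hu⟩ := hall
      obtain ⟨p⟩ := hG.preconnected v u
      obtain ⟨⟨⟨a, b⟩, hab⟩, -, ha, hb⟩ :=
        p.exists_boundary_dart {z | z ∈ w.support} w.start_mem_support hu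
      simp only [mem_ofPred_eq] at ha hb
      let w' : G.Walk v v :=
        (w.takeUntil a ha).append (.cons hab (.cons hab.symm (w.dropUntil a ha)))
      have hlen : w'.length = w.length + 2 := by
        have := congrArg SimpleGraph.Walk.length (w.take_spec ha)
        simp only [SimpleGraph.Walk.length_append] at this
        simp only [w', SimpleGraph.Walk.length_append, SimpleGraph.Walk.length_cons]
        omega
      have hmem : ∀ z ∈ insert b w.support.toFinset, z ∈ w'.support.toFinset := by
        intro z hz
        simp only [List.mem_toFinset, w', SimpleGraph.Walk.mem_support_append_iff,
          SimpleGraph.Walk.support_cons, List.mem_cons]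
        rcases Finset.mem_insert.1 hz with rfl | hz
        · simp
        · rw [List.mem_toFinset, ← w.take_spec ha,
            SimpleGraph.Walk.mem_support_append_iff] at hz
          tauto
      refine ⟨w', by omega, Or.inr ?_⟩
      have := Finset.card_le_card hmem
      rw [Finset.card_insert_of_notMem (by simpa using hb)] at this
      omega
  obtain ⟨w, hw, h | h⟩ := key (Fintype.card V)
  · exact ⟨w, h, hw⟩
  · have := Finset.card_le_univ w.support.toFinset
    omega

/-- A compact metric space contains a finite maximal `ε`-separated set. -/
theorem exists_finset_separated_cover {X : Type*} [MetricSpace X] [CompactSpace X] {ε : ℝ}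
    (hε : 0 < ε) : ∃ s : Finset X, (∀ x ∈ s, ∀ y ∈ s, x ≠ y → ε < dist x y) ∧
      ∀ y, ∃ x ∈ s, dist y x ≤ ε := by
  obtain ⟨t, -, htf, ht⟩ := (isCompact_univ (X := X)).finite_cover_balls (half_pos hε)
  let e : ℝ≥0 := ⟨ε, hε.le⟩
  have hcov : Metric.IsCover (e / 2) univ t := by
    intro y hy
    obtain ⟨x, hx, hxy⟩ := mem_iUnion₂.1 (ht hy)
    refine ⟨x, hx, ?_⟩
    change edist y x ≤ ((e / 2 : ℝ≥0) : ℝ≥0∞)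
    rw [edist_le_coe, ← NNReal.coe_le_coe, coe_nndist]
    exact (Metric.mem_ball.1 hxy).le
  have hne : Metric.packingNumber e (univ : Set X) ≠ ⊤ := by
    have h1 := Metric.packingNumber_two_mul_le_externalCoveringNumber (e / 2) (univ : Set X)
    rw [mul_div_cancel₀ e (two_ne_zero)] at h1
    exact ne_top_of_le_ne_top (Set.encard_ne_top_iff.2 htf)
      (h1.trans hcov.externalCoveringNumber_le_encard)
  have hfin : (Metric.maximalSeparatedSet e (univ : Set X)).Finite := by
    rw [← Set.encard_ne_top_iff, Metric.encard_maximalSeparatedSet hne]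
    exact hne
  refine ⟨hfin.toFinset, fun x hx y hy hxy => ?_, fun y => ?_⟩
  · have := Metric.isSeparated_maximalSeparatedSet (hfin.mem_toFinset.1 hx)
      (hfin.mem_toFinset.1 hy) hxy
    change (e : ℝ≥0∞) < edist x y at this
    rw [edist_nndist, ENNReal.coe_lt_coe] at this
    exact this
  · obtain ⟨x, hx, hxy⟩ := Metric.isCover_maximalSeparatedSet hne (mem_univ y)
    refine ⟨x, hfin.mem_toFinset.2 hx, ?_⟩
    change edist y x ≤ (e : ℝ≥0∞) at hxy
    rw [edist_le_coe] at hxy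
    exact hxy

/-- In a connected metric space, any two points of a finite `ε`-net are joined by a chain in the
net with steps at most `2 * ε`, since otherwise closed `ε`-balls would disconnect the space. -/
theorem connected_of_cover {X : Type*} [MetricSpace X] [PreconnectedSpace X] [Nonempty X] {ε : ℝ}
    (s : Finset X) (hs : ∀ y, ∃ x ∈ s, dist y x ≤ ε) :
    (SimpleGraph.fromRel fun a b : s => dist (a : X) b ≤ 2 * ε).Connected := by
  set G := SimpleGraph.fromRel fun a b : s => dist (a : X) b ≤ 2 * ε with hGdef
  have hne : Nonempty s := by
    obtain ⟨x, hx, -⟩ := hs (Classical.arbitrary X)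
    exact ⟨⟨x, hx⟩⟩
  refine ⟨fun a b => ?_⟩
  by_contra hab
  let U : Set s := {c | G.Reachable a c}
  have hclosed : ∀ W : Set s, IsClosed (⋃ c ∈ W, Metric.closedBall (c : X) ε) := fun W =>
    (Set.toFinite W).isClosed_biUnion fun _ _ => Metric.isClosed_closedBall
  have hε : 0 ≤ ε := by
    obtain ⟨x, -, hx⟩ := hs (Classical.arbitrary X)
    exact dist_nonneg.trans hx
  have := isPreconnected_closed_iff.1 (isPreconnected_univ (α := X)) _ _ (hclosed U) (hclosed Uᶜ)
    (by
      intro y _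
      obtain ⟨x, hx, hxy⟩ := hs y
      by_cases h : (⟨x, hx⟩ : s) ∈ U
      · exact Or.inl (mem_iUnion₂.2 ⟨_, h, hxy⟩)
      · exact Or.inr (mem_iUnion₂.2 ⟨_, h, hxy⟩))
    ⟨a, mem_univ _, mem_iUnion₂.2 ⟨a, SimpleGraph.Reachable.refl a, Metric.mem_closedBall_self hε⟩⟩
    ⟨b, mem_univ _, mem_iUnion₂.2 ⟨b, hab, Metric.mem_closedBall_self hε⟩⟩
  obtain ⟨z, -, hz1, hz2⟩ := this
  obtain ⟨c, hc, hzc⟩ := mem_iUnion₂.1 hz1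
  obtain ⟨d, hd, hzd⟩ := mem_iUnion₂.1 hz2
  refine hd (SimpleGraph.Reachable.trans hc (SimpleGraph.Adj.reachable ?_))
  rw [hGdef, SimpleGraph.fromRel_adj]
  refine ⟨fun h => hd (h ▸ hc), Or.inl ?_⟩
  have := dist_triangle_left (c : X) d z
  rw [Metric.mem_closedBall] at hzc hzd
  linarith

/-- At scale `ε`, a continuum of finite length `L` is swept out, up to errors of size `ε`, by a
discrete path of speed `2` during a time at most `4 * L`. -/
theorem exists_discrete_path {X : Type*} [MetricSpace X] [CompactSpace X] [ConnectedSpace X]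
    [MeasurableSpace X] [BorelSpace X] (hfin : μH[1] (univ : Set X) < ⊤) {a b : X} {ε : ℝ}
    (hε : 0 < ε) (hab : 2 * ε ≤ dist a b) :
    ∃ f : ℝ → X, (∀ s t, dist (f s) (f t) ≤ 2 * |s - t| + 2 * ε) ∧
      ∀ y, ∃ t ∈ Icc 0 (4 * (μH[1] (univ : Set X)).toReal), dist y (f t) ≤ ε := by
  obtain ⟨s, hsep, hcov⟩ := exists_finset_separated_cover (X := X) hε
  have hconn := connected_of_cover s hcov
  set G := SimpleGraph.fromRel fun a b : s => dist (a : X) b ≤ 2 * ε with hGdef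
  obtain ⟨v⟩ := hconn.nonempty
  obtain ⟨w, hw, hlen⟩ := hconn.exists_covering_walk v
  rw [Fintype.card_coe] at hlen
  -- The half-radius balls around the net points are disjoint and each has length at least `ε / 2`.
  have hcard : s.card * (ε / 2) ≤ (μH[1] (univ : Set X)).toReal := by
    have hdisj : (s : Set X).PairwiseDisjoint fun x => Metric.ball x (ε / 2) := by
      intro x hx y hy hxy
      refine Metric.ball_disjoint_ball ?_
      linarith [hsep x hx y hy hxy]
    have hball : ∀ x ∈ s, ENNReal.ofReal (ε / 2) ≤ μH[1] (Metric.ball x (ε / 2)) := by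
      intro x _
      have : ∃ y, ε / 2 ≤ dist y x := by
        by_contra! h
        linarith [dist_triangle_right a b x, h a, h b]
      obtain ⟨y, hy⟩ := this
      simpa using isPreconnected_univ.ofReal_le_hausdorffMeasure_inter_ball (mem_univ x)
        (mem_univ y) hy
    have h1 : ∑ _x ∈ s, ENNReal.ofReal (ε / 2) ≤ μH[1] (univ : Set X) :=
      (Finset.sum_le_sum hball).trans
        ((measure_biUnion_finset hdisj fun _ _ => Metric.isOpen_ball.measurableSet).symm.le.trans
          (measure_mono (subset_univ _)))
    have h2 := ENNReal.toReal_mono hfin.ne h1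
    rw [Finset.sum_const, nsmul_eq_mul, ENNReal.toReal_mul, ENNReal.toReal_ofReal (by positivity)]
      at h2
    simpa using h2
  let g : ℕ → X := fun k => (w.getVert k : X)
  have hstep : ∀ k, dist (g k) (g (k + 1)) ≤ 2 * ε := by
    intro k
    by_cases hk : k < w.length
    · have := (SimpleGraph.fromRel_adj _ _ _).1 (w.adj_getVert_succ hk)
      rcases this.2 with h | h
      · exact h
      · rw [dist_comm]; exact h
    · have h1 : g k = g (k + 1) := by
        simp only [g]
        rw [w.getVert_of_length_le (by omega), w.getVert_of_length_le (by omega)]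
      rw [h1, dist_self]
      positivity
  have hdist : ∀ i j : ℕ, i ≤ j → dist (g i) (g j) ≤ ((j : ℝ) - i) * (2 * ε) := by
    intro i j hij
    have := dist_le_Ico_sum_of_dist_le hij (f := g) (d := fun _ => 2 * ε) fun {k} _ _ => hstep k
    rw [Finset.sum_const, Nat.card_Ico, nsmul_eq_mul, Nat.cast_sub hij] at this
    exact this
  have hmono : ∀ s t : ℝ, s ≤ t →
      dist (g ⌊s / ε⌋₊) (g ⌊t / ε⌋₊) ≤ 2 * (t - s) + 2 * ε := by
    intro s t hst
    have hle : ⌊s / ε⌋₊ ≤ ⌊t / ε⌋₊ := Nat.floor_mono (by gcongr)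
    refine (hdist _ _ hle).trans ?_
    have h1 : s / ε < ⌊s / ε⌋₊ + 1 := Nat.lt_floor_add_one _
    rw [div_lt_iff₀ hε] at h1
    rcases le_or_gt 0 t with ht | ht
    · have h2 : (⌊t / ε⌋₊ : ℝ) ≤ t / ε := Nat.floor_le (by positivity)
      rw [le_div_iff₀ hε] at h2
      nlinarith
    · have h2 : ⌊t / ε⌋₊ = 0 := Nat.floor_of_nonpos (div_nonpos_of_nonpos_of_nonneg ht.le hε.le)
      rw [h2] at hle ⊢
      rw [Nat.le_zero.1 hle]
      norm_num
      linarith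
  refine ⟨fun t => g ⌊t / ε⌋₊, fun s t => ?_, fun y => ?_⟩
  · rcases le_total s t with h | h
    · rw [abs_sub_comm, abs_of_nonneg (sub_nonneg.2 h)]
      exact hmono s t h
    · rw [abs_of_nonneg (sub_nonneg.2 h), dist_comm]
      exact hmono t s h
  · obtain ⟨x, hx, hxy⟩ := hcov y
    obtain ⟨k, hk, hkl⟩ := SimpleGraph.Walk.mem_support_iff_exists_getVert.1 (hw ⟨x, hx⟩)
    have hk2 : (k : ℝ) ≤ 2 * s.card := by exact_mod_cast hkl.trans hlen
    refine ⟨k * ε, ⟨by positivity, by nlinarith⟩, ?_⟩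
    simp only [mul_div_cancel_right₀ _ hε.ne', Nat.floor_natCast, g, hk]
    exact hxy

/-- A compact connected metric space of finite length is the image of a Lipschitz curve. The curve
is an ultrafilter limit of discrete paths at finer and finer scales. -/
theorem exists_lipschitz_surjective {X : Type*} [MetricSpace X] [CompactSpace X]
    [ConnectedSpace X] [MeasurableSpace X] [BorelSpace X] (hfin : μH[1] (univ : Set X) < ⊤) :
    ∃ f : ℝ → X, LipschitzWith 2 f ∧ Function.Surjective f := by
  rcases subsingleton_or_nontrivial X with hX | hX
  · obtain ⟨x⟩ := (inferInstance : Nonempty X)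
    exact ⟨fun _ => x, LipschitzWith.const' x, fun y => ⟨0, Subsingleton.elim _ _⟩⟩
  obtain ⟨a, b, hab⟩ := exists_pair_ne X
  have hd : 0 < dist a b := dist_pos.2 hab
  let e : ℕ → ℝ := fun m => dist a b / 2 * (1 / ((m : ℝ) + 1))
  have he : ∀ m, 0 < e m := fun m => by positivity
  have he2 : ∀ m, 2 * e m ≤ dist a b := by
    intro m
    have : 1 / ((m : ℝ) + 1) ≤ 1 := by
      rw [div_le_one (by positivity)]
      linarith [(Nat.cast_nonneg m : (0 : ℝ) ≤ m)]
    simp only [e]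
    nlinarith
  have hlim : Filter.Tendsto e Filter.atTop (nhds 0) := by
    simpa [e] using
      (tendsto_one_div_add_atTop_nhds_zero_nat (𝕜 := ℝ)).const_mul (dist a b / 2)
  choose F hF1 hF2 using fun m => exists_discrete_path hfin (he m) (he2 m)
  let u : Ultrafilter ℕ := Ultrafilter.of Filter.atTop
  have hu : Filter.Tendsto e u (nhds 0) := hlim.mono_left (Ultrafilter.of_le _)
  have hconv : ∀ t, ∃ x, Filter.Tendsto (fun m => F m t) u (nhds x) := by
    intro t
    obtain ⟨x, -, hx⟩ := (isCompact_univ (X := X)).ultrafilter_le_nhds' (u.map fun m => F m t)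
      Filter.univ_mem
    exact ⟨x, hx⟩
  choose f hf using hconv
  refine ⟨f, LipschitzWith.of_dist_le_mul fun s t => ?_, fun y => ?_⟩
  · have h1 := (hf s).dist (hf t)
    have h2 : Filter.Tendsto (fun m => 2 * |s - t| + 2 * e m) u (nhds (2 * |s - t| + 2 * 0)) :=
      tendsto_const_nhds.add (hu.const_mul 2)
    have := le_of_tendsto_of_tendsto' h1 h2 fun m => hF1 m s t
    simpa [Real.dist_eq] using this
  · choose τ hτ hyτ using fun m => hF2 m y
    obtain ⟨t, -, ht⟩ := (isCompact_Icc (a := (0 : ℝ))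
      (b := 4 * (μH[1] (univ : Set X)).toReal)).ultrafilter_le_nhds' (u.map τ)
      (Filter.mem_map.2 (Filter.univ_mem' hτ))
    have ht' : Filter.Tendsto τ u (nhds t) := ht
    refine ⟨t, (dist_le_zero.1 ?_).symm⟩
    have h1 : Filter.Tendsto (fun m => dist y (F m t)) u (nhds (dist y (f t))) :=
      tendsto_const_nhds.dist (hf t)
    have h2 : Filter.Tendsto (fun m => e m + (2 * |τ m - t| + 2 * e m)) u
        (nhds (0 + (2 * |t - t| + 2 * 0))) :=
      hu.add (((ht'.sub_const t).abs.const_mul 2).add (hu.const_mul 2))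
    have := le_of_tendsto_of_tendsto' h1 h2 fun m =>
      (dist_triangle y (F m (τ m)) (F m t)).trans (add_le_add (hyτ m) (hF1 m _ _))
    simpa using this

/-- Compact connected sets of finite length are rectifiable. -/
theorem IsRectifiable.of_isCompact_of_isConnected {X : Type*} [MetricSpace X] [MeasurableSpace X]
    [BorelSpace X] {E : Set X} (hE : IsCompact E) (hconn : IsConnected E)
    (hfin : μH[1] E < ⊤) : IsRectifiable 1 E := by
  have : CompactSpace E := isCompact_iff_compactSpace.1 hE
  have : ConnectedSpace E := isConnected_iff_connectedSpace.1 hconn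
  have hfin' : μH[1] (univ : Set E) < ⊤ := by
    rw [← (isometry_subtype_coe (s := E)).hausdorffMeasure_image (Or.inl zero_le_one)]
    simpa using hfin
  obtain ⟨f, hf, hsurj⟩ := exists_lipschitz_surjective hfin'
  have hcoord : LipschitzWith 1 fun t : EuclideanSpace ℝ (Fin 1) => t 0 :=
    LipschitzWith.of_dist_le_mul fun s t => by
      simpa [Real.dist_eq, EuclideanSpace.dist_eq] using (Real.sqrt_sq_eq_abs _).ge
  refine ⟨fun _ t => (f (t 0) : X), fun _ => ⟨_, (LipschitzWith.subtype_val E).comp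
    (hf.comp hcoord)⟩, ?_⟩
  have : E \ ⋃ _ : ℕ, range (fun t : EuclideanSpace ℝ (Fin 1) => (f (t 0) : X)) = ∅ := by
    refine sdiff_eq_empty.2 fun x hx => mem_iUnion.2 ⟨0, ?_⟩
    obtain ⟨t, ht⟩ := hsurj ⟨x, hx⟩
    exact ⟨WithLp.toLp 2 fun _ => t, by simp [ht]⟩
  rw [this, measure_empty]

/-! ### Smooth functions on the torus -/

namespace Torus

variable {n : ℕ}

theorem proj_surjective : Function.Surjective (proj : EuclideanSpace ℝ (Fin n) → Torus n) :=
  QuotientAddGroup.mk_surjective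

theorem proj_eq_proj_iff {a b : EuclideanSpace ℝ (Fin n)} :
    (proj a : Torus n) = proj b ↔ ∀ i, ∃ k : ℤ, (k : ℝ) = b i - a i := by
  refine (QuotientAddGroup.eq (s := integerLattice n)).trans (forall_congr' fun i => ?_)
  rw [PiLp.add_apply, PiLp.neg_apply, neg_add_eq_sub]

/-- The function `[y] ↦ g (y i)` on the torus, for a function `g` of period one. -/
noncomputable def ofPeriodic (g : ℝ → ℝ) (i : Fin n) (x : Torus n) : ℝ :=
  g ((Quotient.out x : EuclideanSpace ℝ (Fin n)) i)

theorem ofPeriodic_proj {g : ℝ → ℝ} (hg : Function.Periodic g 1) (i : Fin n)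
    (y : EuclideanSpace ℝ (Fin n)) : ofPeriodic g i (proj y) = g (y i) := by
  have hout : (proj (Quotient.out (proj y)) : Torus n) = proj y := Quotient.out_eq _
  obtain ⟨k, hk⟩ := proj_eq_proj_iff.1 hout i
  have h := (hg.int_mul k) ((Quotient.out (proj y) : EuclideanSpace ℝ (Fin n)) i)
  rw [mul_one, hk, add_sub_cancel] at h
  exact h.symm

theorem contDiff_ofPeriodic {g : ℝ → ℝ} (hg : Function.Periodic g 1) (hs : ContDiff ℝ ∞ g)
    (i : Fin n) :
    ContDiff ℝ ∞ (ofPeriodic g i ∘ (proj : EuclideanSpace ℝ (Fin n) → Torus n)) := by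
  have : ofPeriodic g i ∘ (proj : EuclideanSpace ℝ (Fin n) → Torus n) = fun y => g (y i) :=
    funext fun y => ofPeriodic_proj hg i y
  rw [this]
  exact hs.comp (EuclideanSpace.proj (𝕜 := ℝ) i).contDiff

theorem continuous_of_contDiff {f : Torus n → ℝ}
    (hf : ContDiff ℝ ∞ (f ∘ (proj : EuclideanSpace ℝ (Fin n) → Torus n))) : Continuous f :=
  (isQuotientMap_quotient_mk' : Topology.IsQuotientMap
    (proj : EuclideanSpace ℝ (Fin n) → Torus n)).continuous_iff.2 hf.continuous

/-- The smooth functions, as a subalgebra of the continuous functions on the torus. -/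
def smoothSubalgebra (n : ℕ) : Subalgebra ℝ C(Torus n, ℝ) where
  carrier := {f | ContDiff ℝ ∞ (f ∘ (proj : EuclideanSpace ℝ (Fin n) → Torus n))}
  mul_mem' := fun {a b} (ha : ContDiff ℝ ∞ (a ∘ proj)) (hb : ContDiff ℝ ∞ (b ∘ proj)) =>
    ContDiff.mul ha hb
  add_mem' := fun {a b} (ha : ContDiff ℝ ∞ (a ∘ proj)) (hb : ContDiff ℝ ∞ (b ∘ proj)) =>
    ContDiff.add ha hb
  algebraMap_mem' := fun c =>
    (contDiff_const : ContDiff ℝ ∞ fun _ : EuclideanSpace ℝ (Fin n) => c)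

theorem separatesPoints_smoothSubalgebra (n : ℕ) : (smoothSubalgebra n).SeparatesPoints := by
  intro x y hxy
  obtain ⟨a, rfl⟩ := proj_surjective x
  obtain ⟨b, rfl⟩ := proj_surjective y
  by_contra hsep
  refine hxy (proj_eq_proj_iff.2 fun i => ?_)
  let g : ℝ → ℝ := fun t => Real.cos (2 * Real.pi * (t - a i))
  have hg : Function.Periodic g 1 := by
    intro t
    simp only [g]
    rw [← Real.cos_add_two_pi (2 * Real.pi * (t - a i))]
    congr 1
    ring
  have hsm : ContDiff ℝ ∞ g :=
    Real.contDiff_cos.comp (contDiff_const.mul (contDiff_id.sub contDiff_const))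
  have hc := contDiff_ofPeriodic hg hsm i
  have h : g (a i) = g (b i) := by
    by_contra hne
    refine hsep ⟨ofPeriodic g i, ⟨⟨_, continuous_of_contDiff hc⟩, hc, rfl⟩, ?_⟩
    rwa [ofPeriodic_proj hg, ofPeriodic_proj hg]
  have h1 : Real.cos (2 * Real.pi * (b i - a i)) = 1 := by
    rw [← show g (b i) = Real.cos (2 * Real.pi * (b i - a i)) from rfl, ← h]
    simp [g]
  obtain ⟨k, hk⟩ := (Real.cos_eq_one_iff _).1 h1
  refine ⟨k, mul_right_cancel₀ Real.two_pi_pos.ne' ?_⟩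
  linarith

/-- A smooth Urysohn lemma on the torus: a smooth step function is applied to a smooth function
uniformly close to a continuous Urysohn function. -/
theorem exists_smooth_one_zero {A B : Set (Torus n)} (hA : IsClosed A) (hB : IsClosed B)
    (hAB : Disjoint A B) :
    ∃ χ : Torus n → ℝ, ContDiff ℝ ∞ (χ ∘ (proj : EuclideanSpace ℝ (Fin n) → Torus n)) ∧
      (∀ x ∈ A, ∀ᶠ y in nhds x, χ y = 1) ∧ ∀ x ∈ B, ∀ᶠ y in nhds x, χ y = 0 := by
  obtain ⟨f, hf0, hf1, -⟩ := exists_continuous_zero_one_of_isClosed hB hA hAB.symm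
  obtain ⟨⟨g, hgs⟩, hg⟩ := ContinuousMap.exists_mem_subalgebra_near_continuous_of_separatesPoints
    (smoothSubalgebra n) (separatesPoints_smoothSubalgebra n) f f.continuous (1 / 4) (by norm_num)
  have hgs' : ContDiff ℝ ∞ (g ∘ (proj : EuclideanSpace ℝ (Fin n) → Torus n)) := hgs
  refine ⟨fun x => Real.smoothTransition (3 * g x - 1),
    Real.smoothTransition.contDiff.comp ((contDiff_const.mul hgs').sub contDiff_const), ?_, ?_⟩
  · intro x hx
    have h1 := (abs_lt.1 (hg x)).1
    have h2 : f x = 1 := hf1 hx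
    have : 3 / 4 < g x := by
      change -(1 / 4) < g x - f x at h1
      linarith
    filter_upwards [g.continuous.continuousAt.eventually (lt_mem_nhds this)] with y hy
    exact Real.smoothTransition.one_of_one_le (by linarith)
  · intro x hx
    have h1 := (abs_lt.1 (hg x)).2
    have h2 : f x = 0 := hf0 hx
    have : g x < 1 / 4 := by
      change g x - f x < 1 / 4 at h1
      linarith
    filter_upwards [g.continuous.continuousAt.eventually (gt_mem_nhds this)] with y hy
    exact Real.smoothTransition.zero_of_nonpos (by linarith)

theorem grad_congr {φ ψ : Torus n → ℝ} {x : Torus n} (h : ∀ᶠ y in nhds x, φ y = ψ y) :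
    grad φ x = grad ψ x := by
  obtain ⟨a, rfl⟩ := proj_surjective x
  rw [grad_proj, grad_proj]
  have h' : (φ ∘ proj) =ᶠ[nhds a] (ψ ∘ proj) := continuous_proj.continuousAt.eventually h
  simp only [gradient, h'.fderiv_eq]

/-- Smooth functions can be prescribed independently near disjoint closed sets. -/
theorem exists_grad_eq_on {A B : Set (Torus n)} (hA : IsClosed A) (hB : IsClosed B)
    (hAB : Disjoint A B) (φ ψ : smoothFunctions n) :
    ∃ η : smoothFunctions n, (∀ x ∈ A, grad η.1 x = grad φ.1 x) ∧
      ∀ x ∈ B, grad η.1 x = grad ψ.1 x := by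
  obtain ⟨χ, hχ, h1, h0⟩ := exists_smooth_one_zero hA hB hAB
  refine ⟨⟨fun x => χ x * φ.1 x + (1 - χ x) * ψ.1 x,
    ContDiff.add (ContDiff.mul hχ φ.2) (ContDiff.mul (contDiff_const.sub hχ) ψ.2)⟩,
    fun x hx => grad_congr ?_, fun x hx => grad_congr ?_⟩
  · filter_upwards [h1 x hx] with y hy
    simp [hy]
  · filter_upwards [h0 x hx] with y hy
    simp [hy]

/-- A smooth function of period one that agrees with the identity near zero: a truncation of
`arcsin (sin (2πt)) / 2π`. -/
theorem exists_periodic_eq_id : ∃ τ : ℝ → ℝ, Function.Periodic τ 1 ∧ ContDiff ℝ ∞ τ ∧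
    ∀ t, |t| < 1 / 8 → τ t = t := by
  let H : ℝ → ℝ := fun s => Real.smoothTransition (3 - 4 * s ^ 2) * Real.arcsin s
  have hfar : ∀ s : ℝ, 1 ≤ s ^ 2 → ContDiffAt ℝ ∞ H s := by
    intro s hs
    have : H =ᶠ[nhds s] fun _ => 0 := by
      have hopen : ∀ᶠ r in nhds s, 3 / 4 < r ^ 2 :=
        (continuous_pow 2).continuousAt.eventually (lt_mem_nhds (by linarith))
      filter_upwards [hopen] with r hr
      simp only [H]
      rw [Real.smoothTransition.zero_of_nonpos (by linarith), zero_mul]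
    exact contDiffAt_const.congr_of_eventuallyEq this
  have hH : ContDiff ℝ ∞ H := by
    rw [contDiff_iff_contDiffAt]
    intro s
    by_cases h1 : s = -1
    · exact hfar s (by rw [h1]; norm_num)
    by_cases h2 : s = 1
    · exact hfar s (by rw [h2]; norm_num)
    exact (Real.smoothTransition.contDiff.comp
      (contDiff_const.sub (contDiff_const.mul (contDiff_id.pow 2)))).contDiffAt.mul
      (Real.contDiffAt_arcsin h1 h2)
  refine ⟨fun t => H (Real.sin (2 * Real.pi * t)) / (2 * Real.pi), fun t => ?_, ?_, fun t ht => ?_⟩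
  · simp only [mul_add, mul_one, Real.sin_add_two_pi]
  · exact (hH.comp (Real.contDiff_sin.comp (contDiff_const.mul contDiff_id))).div_const _
  · have hpi := Real.pi_pos
    rw [abs_lt] at ht
    have hcos : 0 ≤ Real.cos (2 * (2 * Real.pi * t)) :=
      Real.cos_nonneg_of_neg_pi_div_two_le_of_le (by nlinarith) (by nlinarith)
    rw [Real.cos_two_mul] at hcos
    have hsin := Real.sin_sq_add_cos_sq (2 * Real.pi * t)
    simp only [H]
    rw [Real.smoothTransition.one_of_one_le (by linarith),
      Real.arcsin_sin (by nlinarith) (by nlinarith)]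
    field_simp

theorem exists_proj_of_mem_ball {a : EuclideanSpace ℝ (Fin n)} {z : Torus n} {r : ℝ}
    (hz : z ∈ Metric.ball (proj a) r) : ∃ y, proj y = z ∧ ‖y - a‖ < r := by
  rw [Metric.mem_ball, dist_eq_norm] at hz
  obtain ⟨w, hw, hwr⟩ := QuotientAddGroup.norm_lt_iff.1 hz
  refine ⟨a + w, ?_, by simpa using hwr⟩
  have : (proj (a + w) : Torus n) = proj a + proj w := rfl
  rw [this, show (proj w : Torus n) = z - proj a from hw, add_sub_cancel]

/-- On a small ball every constant vector is the gradient of a smooth function of the torus. -/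
theorem exists_grad_eq_const_on_ball (x : Torus n) (p : EuclideanSpace ℝ (Fin n)) :
    ∃ φ : smoothFunctions n, ∀ z ∈ Metric.ball x (1 / 8), grad φ.1 z = p := by
  obtain ⟨a, rfl⟩ := proj_surjective x
  obtain ⟨τ, hτ, hτs, hτid⟩ := exists_periodic_eq_id
  let g : Fin n → ℝ → ℝ := fun i t => p i * τ (t - a i)
  have hg : ∀ i, Function.Periodic (g i) 1 := by
    intro i t
    simp only [g]
    rw [← hτ (t - a i), add_sub_right_comm]
  have hgs : ∀ i, ContDiff ℝ ∞ (g i) := fun i =>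
    contDiff_const.mul (hτs.comp (contDiff_id.sub contDiff_const))
  refine ⟨∑ i, ⟨ofPeriodic (g i) i, contDiff_ofPeriodic (hg i) (hgs i) i⟩, fun z hz => ?_⟩
  obtain ⟨y, rfl, hy⟩ := exists_proj_of_mem_ball hz
  rw [grad_proj]
  have hev : ((∑ i, (⟨ofPeriodic (g i) i, contDiff_ofPeriodic (hg i) (hgs i) i⟩ :
      smoothFunctions n) : smoothFunctions n).1 ∘ proj) =ᶠ[nhds y]
      fun w => inner ℝ p (w - a) := by
    have hopen : ∀ᶠ w in nhds y, ‖w - a‖ < 1 / 8 :=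
      (continuous_id.sub continuous_const).norm.continuousAt.eventually (gt_mem_nhds hy)
    filter_upwards [hopen] with w hw
    simp only [Function.comp_apply, Submodule.coe_sum, Finset.sum_apply, ofPeriodic_proj (hg _)]
    rw [PiLp.inner_apply]
    refine Finset.sum_congr rfl fun i _ => ?_
    have : |w i - a i| < 1 / 8 := (PiLp.norm_apply_le (w - a) i).trans_lt hw
    simp only [g, hτid _ this, PiLp.sub_apply, RCLike.inner_apply, conj_trivial]
    ring
  have hgrad : HasGradientAt (fun w => inner ℝ p (w - a)) p y := by
    rw [hasGradientAt_iff_hasFDerivAt]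
    have h := (innerSL ℝ p).hasFDerivAt (x := y - a)
    exact h.comp y ((hasFDerivAt_id y).sub_const a)
  rw [gradient, hev.fderiv_eq]
  exact hgrad.gradient

end Torus

/-! ### Effective energy of the restrictions of a medium -/

namespace Medium

variable {n : ℕ}

/-- The integrand `(∇φ + p) · σ (∇φ + p)` of the energy. -/
noncomputable def energyDensity (θ : Medium n) (φ : Torus.smoothFunctions n)
    (p : EuclideanSpace ℝ (Fin n)) (x : Torus n) : ℝ :=
  field (φ, p) x ⬝ᵥ (θ.density x *ᵥ field (φ, p) x)

theorem integrable_energyDensity (θ : Medium n) (φ : Torus.smoothFunctions n)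
    (p : EuclideanSpace ℝ (Fin n)) : Integrable (θ.energyDensity φ p) θ.mass :=
  θ.integrable_energy (φ, p) (φ, p)

theorem ae_energyDensity_nonneg (θ : Medium n) (φ : Torus.smoothFunctions n)
    (p : EuclideanSpace ℝ (Fin n)) : 0 ≤ᵐ[θ.mass] θ.energyDensity φ p := by
  filter_upwards [θ.ae_density_nonneg] with x hx using hx _

theorem mass_restrict (θ : Medium n) {E : Set (Torus n)} (hE : MeasurableSet E) :
    (θ.restrict E).mass = θ.mass.restrict E := by
  ext A hA
  rw [← ENNReal.toReal_eq_toReal_iff' (measure_ne_top _ _) (measure_ne_top _ _),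
    ← measureReal_def, ← measureReal_def, measureReal_restrict_apply hA, mass_real_apply _ hA,
    mass_real_apply _ (hA.inter hE)]
  exact congrArg Matrix.trace (VectorMeasure.restrict_apply _ hE hA)

theorem density_restrict (θ : Medium n) {E : Set (Torus n)} (hE : MeasurableSet E) :
    (θ.restrict E).density =ᵐ[θ.mass.restrict E] θ.density := by
  have key : ∀ i j, (fun x => (θ.restrict E).density x i j) =ᵐ[θ.mass.restrict E]
      fun x => θ.density x i j := by
    intro i j
    have hint := (θ.restrict E).integrable_density i j
    rw [θ.mass_restrict hE] at hint
    refine hint.ae_eq_of_forall_setIntegral_eq _ _ (θ.integrable_density i j).restrict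
      fun A hA _ => ?_
    rw [← θ.mass_restrict hE, (θ.restrict E).setIntegral_density i j hA, θ.mass_restrict hE,
      Measure.restrict_restrict hA, θ.setIntegral_density i j (hA.inter hE)]
    exact congrFun (congrFun (VectorMeasure.restrict_apply _ hE hA) i) j
  filter_upwards [ae_all_iff.2 fun i => ae_all_iff.2 fun j => key i j] with x hx
  ext i j
  exact hx i j

theorem energy_restrict (θ : Medium n) {E : Set (Torus n)} (hE : MeasurableSet E)
    (φ : Torus.smoothFunctions n) (p : EuclideanSpace ℝ (Fin n)) :
    (θ.restrict E).energy φ p = ∫ x in E, θ.energyDensity φ p x ∂θ.mass := by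
  rw [energy, θ.mass_restrict hE]
  refine integral_congr_ae ?_
  filter_upwards [θ.density_restrict hE] with x hx
  rw [hx]
  rfl

theorem effectiveEnergy_le (θ : Medium n) (φ : Torus.smoothFunctions n)
    (p : EuclideanSpace ℝ (Fin n)) : θ.effectiveEnergy p ≤ θ.energy φ p :=
  ciInf_le (f := fun φ : Torus.smoothFunctions n => θ.energy φ p)
    ⟨0, by rintro _ ⟨φ, rfl⟩; exact θ.energyForm_nonneg (φ, p)⟩ φ

theorem exists_energy_lt (θ : Medium n) (p : EuclideanSpace ℝ (Fin n)) {ε : ℝ} (hε : 0 < ε) :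
    ∃ φ : Torus.smoothFunctions n, θ.energy φ p < θ.effectiveEnergy p + ε :=
  exists_lt_of_ciInf_lt (lt_add_of_pos_right _ hε)

theorem effectiveEnergy_restrict_mono (θ : Medium n) {A B : Set (Torus n)} (hA : MeasurableSet A)
    (hB : MeasurableSet B) (hAB : A ⊆ B) (p : EuclideanSpace ℝ (Fin n)) :
    (θ.restrict A).effectiveEnergy p ≤ (θ.restrict B).effectiveEnergy p := by
  refine le_ciInf fun φ => ((θ.restrict A).effectiveEnergy_le φ p).trans ?_
  rw [θ.energy_restrict hA, θ.energy_restrict hB]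
  exact setIntegral_mono_set (θ.integrable_energyDensity φ p).integrableOn
    (ae_restrict_of_ae (θ.ae_energyDensity_nonneg φ p)) hAB.eventuallyLE

theorem setIntegral_energyDensity_congr (θ : Medium n) {A : Set (Torus n)} (hA : MeasurableSet A)
    {φ ψ : Torus.smoothFunctions n} (h : ∀ x ∈ A, Torus.grad φ.1 x = Torus.grad ψ.1 x)
    (p : EuclideanSpace ℝ (Fin n)) :
    ∫ x in A, θ.energyDensity φ p x ∂θ.mass = ∫ x in A, θ.energyDensity ψ p x ∂θ.mass :=
  setIntegral_congr_fun hA fun x hx => by simp only [energyDensity, field, h x hx]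

/-- The effective energy is subadditive on disjoint closed sets, since test functions for the two
sets can be glued. -/
theorem effectiveEnergy_restrict_union_le (θ : Medium n) {A B : Set (Torus n)} (hA : IsClosed A)
    (hB : IsClosed B) (hAB : Disjoint A B) (p : EuclideanSpace ℝ (Fin n)) :
    (θ.restrict (A ∪ B)).effectiveEnergy p ≤
      (θ.restrict A).effectiveEnergy p + (θ.restrict B).effectiveEnergy p := by
  refine le_ciInf_add_ciInf fun φ ψ => ?_
  obtain ⟨η, h1, h2⟩ := Torus.exists_grad_eq_on hA hB hAB φ ψ
  refine ((θ.restrict (A ∪ B)).effectiveEnergy_le η p).trans_eq ?_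
  rw [θ.energy_restrict (hA.union hB).measurableSet, θ.energy_restrict hA.measurableSet,
    θ.energy_restrict hB.measurableSet, setIntegral_union hAB hB.measurableSet
      (θ.integrable_energyDensity η p).integrableOn (θ.integrable_energyDensity η p).integrableOn,
    θ.setIntegral_energyDensity_congr hA.measurableSet h1,
    θ.setIntegral_energyDensity_congr hB.measurableSet h2]

/-- Small pieces of a medium do not conduct: a local linear function cancels the field `p`. -/
theorem effectiveEnergy_restrict_eq_zero (θ : Medium n) {A : Set (Torus n)} (hA : MeasurableSet A)
    {x : Torus n} (hx : A ⊆ Metric.ball x (1 / 8)) (p : EuclideanSpace ℝ (Fin n)) :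
    (θ.restrict A).effectiveEnergy p = 0 := by
  refine le_antisymm ?_ ((θ.restrict A).effectiveEnergy_nonneg p)
  obtain ⟨φ, hφ⟩ := Torus.exists_grad_eq_const_on_ball x (-p)
  refine ((θ.restrict A).effectiveEnergy_le φ p).trans_eq ?_
  rw [θ.energy_restrict hA]
  refine setIntegral_eq_zero_of_forall_eq_zero fun z hz => ?_
  have : field (φ, p) z = 0 := by
    simp [field, hφ z (hx hz)]
  rw [energyDensity, this, zero_dotProduct]

/-- The effective energy is superadditive on disjoint sets. -/
theorem sum_effectiveEnergy_restrict_le (θ : Medium n) (t : Finset (Set (Torus n)))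
    (hmeas : ∀ E ∈ t, MeasurableSet E) (hdisj : (t : Set (Set (Torus n))).PairwiseDisjoint id)
    (p : EuclideanSpace ℝ (Fin n)) :
    ∑ E ∈ t, (θ.restrict E).effectiveEnergy p ≤ θ.effectiveEnergy p := by
  refine le_ciInf fun φ => ?_
  calc ∑ E ∈ t, (θ.restrict E).effectiveEnergy p
      ≤ ∑ E ∈ t, ∫ x in E, θ.energyDensity φ p x ∂θ.mass := by
        refine Finset.sum_le_sum fun E hE => ?_
        rw [← θ.energy_restrict (hmeas E hE)]
        exact (θ.restrict E).effectiveEnergy_le φ p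
    _ = ∫ x in ⋃ E ∈ t, E, θ.energyDensity φ p x ∂θ.mass :=
        (integral_biUnion_finset t hmeas hdisj fun _ _ =>
          (θ.integrable_energyDensity φ p).integrableOn).symm
    _ ≤ ∫ x, θ.energyDensity φ p x ∂θ.mass :=
        setIntegral_le_integral (θ.integrable_energyDensity φ p) (θ.ae_energyDensity_nonneg φ p)

theorem isClosed_support (θ : Medium n) : IsClosed θ.support :=
  Measure.isClosed_support

theorem effectiveEnergy_restrict_support (θ : Medium n) (p : EuclideanSpace ℝ (Fin n)) :
    (θ.restrict θ.support).effectiveEnergy p = θ.effectiveEnergy p := by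
  refine iInf_congr fun φ => ?_
  rw [θ.energy_restrict θ.isClosed_support.measurableSet, support,
    Measure.restrict_eq_self_of_ae_mem (s := θ.mass.support) Measure.support_mem_ae]
  rfl

/-- The effective energy is outer regular. -/
theorem exists_isOpen_effectiveEnergy_restrict_le (θ : Medium n) {E : Set (Torus n)}
    (hE : MeasurableSet E) (p : EuclideanSpace ℝ (Fin n)) {ε : ℝ} (hε : 0 < ε) :
    ∃ O, IsOpen O ∧ E ⊆ O ∧ ∀ U, MeasurableSet U → U ⊆ O →
      (θ.restrict U).effectiveEnergy p ≤ (θ.restrict E).effectiveEnergy p + ε := by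
  obtain ⟨φ, hφ⟩ := (θ.restrict E).exists_energy_lt p (half_pos hε)
  rw [θ.energy_restrict hE] at hφ
  have hint := θ.integrable_energyDensity φ p
  let ν : Measure (Torus n) :=
    θ.mass.withDensity fun x => ENNReal.ofReal (θ.energyDensity φ p x)
  have : IsFiniteMeasure ν := isFiniteMeasure_withDensity_ofReal hint.2
  have hν : ∀ U, MeasurableSet U → ν U =
      ENNReal.ofReal (∫ x in U, θ.energyDensity φ p x ∂θ.mass) := by
    intro U hU
    rw [withDensity_apply _ hU, ofReal_integral_eq_lintegral_ofReal hint.restrict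
      (ae_restrict_of_ae (θ.ae_energyDensity_nonneg φ p))]
  have hnn : ∀ U : Set (Torus n), 0 ≤ ∫ x in U, θ.energyDensity φ p x ∂θ.mass := fun U =>
    integral_nonneg_of_ae (ae_restrict_of_ae (θ.ae_energyDensity_nonneg φ p))
  obtain ⟨O, hEO, hO, hνO⟩ := E.exists_isOpen_lt_add (μ := ν) (measure_ne_top _ _)
    (ENNReal.ofReal_pos.2 (half_pos hε)).ne'
  refine ⟨O, hO, hEO, fun U hU hUO => ((θ.restrict U).effectiveEnergy_le φ p).trans ?_⟩
  rw [θ.energy_restrict hU]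
  have h := (measure_mono hUO).trans hνO.le
  rw [hν U hU, hν E hE, ← ENNReal.ofReal_add (hnn E) (half_pos hε).le,
    ENNReal.ofReal_le_ofReal_iff (add_nonneg (hnn E) (half_pos hε).le)] at h
  linarith

end Medium

/-! ### Components of a compact set -/

section Components

variable {X : Type*} [TopologicalSpace X] {S E F : Set X}

theorem IsComponentOf.subset (h : IsComponentOf E S) : E ⊆ S := by
  obtain ⟨x, -, rfl⟩ := h
  exact connectedComponentIn_subset S x

theorem IsComponentOf.isConnected (h : IsComponentOf E S) : IsConnected E := by
  obtain ⟨x, hx, rfl⟩ := h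
  exact isConnected_connectedComponentIn_iff.2 hx

theorem IsComponentOf.isClosed (h : IsComponentOf E S) (hS : IsClosed S) : IsClosed E := by
  obtain ⟨x, hx, rfl⟩ := h
  rw [connectedComponentIn_eq_image hx]
  exact hS.isClosedEmbedding_subtypeVal.isClosedMap _ isClosed_connectedComponent

theorem IsComponentOf.disjoint (hE : IsComponentOf E S) (hF : IsComponentOf F S) (hne : E ≠ F) :
    Disjoint E F := by
  obtain ⟨x, -, rfl⟩ := hE
  obtain ⟨y, -, rfl⟩ := hF
  rw [Set.disjoint_left]
  intro z hzx hzy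
  exact hne ((connectedComponentIn_eq hzx).trans (connectedComponentIn_eq hzy).symm)

/-- A component of a compact set has arbitrarily small neighbourhoods that are clopen relative to
the set. -/
theorem IsComponentOf.exists_relative_clopen [T2Space X] (hS : IsCompact S)
    (hE : IsComponentOf E S) {O : Set X} (hO : IsOpen O) (hEO : E ⊆ O) :
    ∃ U, IsClosed U ∧ IsClosed (S \ U) ∧ U ⊆ S ∧ E ⊆ U ∧ U ⊆ O := by
  have : CompactSpace S := isCompact_iff_compactSpace.1 hS
  obtain ⟨x, hx, rfl⟩ := hE
  rw [connectedComponentIn_eq_image hx] at hEO ⊢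
  let ι := {s : Set S // IsClopen s ∧ (⟨x, hx⟩ : S) ∈ s}
  have : Nonempty ι := ⟨⟨univ, isClopen_univ, mem_univ _⟩⟩
  obtain ⟨⟨s, hs, hxs⟩, hsO⟩ : ∃ i : ι, (i : Set S) ⊆ Subtype.val ⁻¹' O := by
    refine exists_subset_nhds_of_isCompact (V := fun i : ι => (i : Set S)) ?_
      (fun i => i.2.1.isClosed.isCompact) fun y hy => ?_
    · intro a b
      exact ⟨⟨a.1 ∩ b.1, a.2.1.inter b.2.1, a.2.2, b.2.2⟩, inter_subset_left, inter_subset_right⟩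
    · rw [← connectedComponent_eq_iInter_isClopen] at hy
      exact (hO.preimage continuous_subtype_val).mem_nhds (hEO ⟨y, hy, rfl⟩)
  refine ⟨Subtype.val '' s, hS.isClosed.isClosedEmbedding_subtypeVal.isClosedMap _ hs.isClosed, ?_,
    Subtype.coe_image_subset S s, image_mono (hs.connectedComponent_subset hxs),
    image_subset_iff.2 hsO⟩
  have : S \ Subtype.val '' s = Subtype.val '' sᶜ := by
    rw [image_compl_eq_range_sdiff_image Subtype.val_injective, Subtype.range_coe]
  rw [this]
  exact hS.isClosed.isClosedEmbedding_subtypeVal.isClosedMap _ hs.compl.isClosed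

end Components

/-- A set of finite length has finitely many closed components of length at least `r`. -/
theorem finite_setOf_isComponentOf_le_hausdorffMeasure {X : Type*} [MetricSpace X]
    [MeasurableSpace X] [BorelSpace X] {S : Set X} (hS : IsClosed S) (hfin : μH[1] S < ⊤)
    {r : ℝ≥0∞} (hr : 0 < r) : {E | IsComponentOf E S ∧ r ≤ μH[1] E}.Finite := by
  have h := Measure.finite_const_le_meas_of_disjoint_iUnion (μH[1] : Measure X) hr
    (As := fun C : {E // IsComponentOf E S} => (C : Set X))
    (fun C => (C.2.isClosed hS).measurableSet)
    (fun C D hCD => C.2.disjoint D.2 (Subtype.coe_injective.ne hCD))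
    (ne_top_of_le_ne_top hfin.ne (measure_mono (iUnion_subset fun C => C.2.subset)))
  exact (h.image Subtype.val).subset fun E hE => ⟨⟨E, hE.1⟩, hE.2, rfl⟩

/-! ### Decomposition of the effective tensor -/

namespace Medium

variable {n : ℕ}

/-- The effective energy is subadditive on finite families of relatively clopen sets. -/
theorem effectiveEnergy_restrict_biUnion_le (θ : Medium n) {S : Set (Torus n)} {ι : Type*}
    (t : Finset ι) (U : ι → Set (Torus n)) (hU : ∀ i, IsClosed (U i))
    (hUc : ∀ i, IsClosed (S \ U i)) (hUS : ∀ i, U i ⊆ S) (p : EuclideanSpace ℝ (Fin n)) :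
    (θ.restrict (⋃ i ∈ t, U i)).effectiveEnergy p ≤
      ∑ i ∈ t, (θ.restrict (U i)).effectiveEnergy p := by
  classical
  induction t using Finset.induction_on with
  | empty =>
    simpa using (θ.effectiveEnergy_restrict_eq_zero (x := 0) MeasurableSet.empty
      (empty_subset _) p).le
  | insert a t ha ih =>
    rw [Finset.sum_insert ha, Finset.set_biUnion_insert]
    set W := ⋃ i ∈ t, U i with hW
    have hWc : IsClosed W := isClosed_biUnion_finset fun i _ => hU i
    have hWS : W ⊆ S := iUnion₂_subset fun i _ => hUS i
    have hsplit : U a ∪ W = U a ∪ (W ∩ (S \ U a)) := by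
      ext z
      have := @hWS z
      simp only [mem_union, mem_inter_iff, mem_sdiff]
      tauto
    rw [hsplit]
    refine (θ.effectiveEnergy_restrict_union_le (hU a) (hWc.inter (hUc a)) ?_ p).trans
      (add_le_add le_rfl ((θ.effectiveEnergy_restrict_mono (hWc.inter (hUc a)).measurableSet
        hWc.measurableSet inter_subset_left p).trans ih))
    exact Set.disjoint_left.2 fun z hz hz' => hz'.2.2 hz

/-- If every component of the support outside a finite family `t` lies in a small ball, then the
components in `t` carry all of the effective energy. -/
theorem effectiveEnergy_le_sum (θ : Medium n) (t : Finset (Set (Torus n)))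
    (ht : ∀ E, IsComponentOf E θ.support → E ∉ t → ∃ x, E ⊆ Metric.ball x (1 / 8))
    (p : EuclideanSpace ℝ (Fin n)) :
    θ.effectiveEnergy p ≤ ∑ E ∈ t, (θ.restrict E).effectiveEnergy p := by
  classical
  have hS : IsCompact θ.support := θ.isClosed_support.isCompact
  have hnn : ∀ E, 0 ≤ (θ.restrict E).effectiveEnergy p := fun E =>
    (θ.restrict E).effectiveEnergy_nonneg p
  have key : ∀ ε : ℝ, 0 < ε →
      θ.effectiveEnergy p ≤ ∑ E ∈ t, ((θ.restrict E).effectiveEnergy p + ε) := by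
    intro ε hε
    have hnbhd : ∀ C : {E // IsComponentOf E θ.support}, ∃ U, IsClosed U ∧
        IsClosed (θ.support \ U) ∧ U ⊆ θ.support ∧ C.1 ⊆ U ∧
        (θ.restrict U).effectiveEnergy p ≤
          if C.1 ∈ t then (θ.restrict C.1).effectiveEnergy p + ε else 0 := by
      rintro ⟨E, hE⟩
      by_cases hEt : E ∈ t
      · obtain ⟨O, hO, hEO, hq⟩ := θ.exists_isOpen_effectiveEnergy_restrict_le
          (hE.isClosed hS.isClosed).measurableSet p hε
        obtain ⟨U, h1, h2, h3, h4, h5⟩ := hE.exists_relative_clopen hS hO hEO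
        refine ⟨U, h1, h2, h3, h4, ?_⟩
        rw [if_pos hEt]
        exact hq U h1.measurableSet h5
      · obtain ⟨x, hx⟩ := ht E hE hEt
        obtain ⟨U, h1, h2, h3, h4, h5⟩ := hE.exists_relative_clopen hS Metric.isOpen_ball hx
        refine ⟨U, h1, h2, h3, h4, ?_⟩
        rw [if_neg hEt]
        exact (θ.effectiveEnergy_restrict_eq_zero h1.measurableSet h5 p).le
    choose U hU hUc hUS hCU hq using hnbhd
    obtain ⟨s, hs⟩ := hS.elim_finite_subcover (fun C => (θ.support \ U C)ᶜ)
      (fun C => (hUc C).isOpen_compl) fun x hx => mem_iUnion.2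
        ⟨⟨_, x, hx, rfl⟩, fun h => h.2 (hCU _ (mem_connectedComponentIn hx))⟩
    have hcover : θ.support ⊆ ⋃ C ∈ s, U C := by
      intro x hx
      obtain ⟨C, hC, hxC⟩ := mem_iUnion₂.1 (hs hx)
      exact mem_iUnion₂.2 ⟨C, hC, by_contra fun h => hxC ⟨hx, h⟩⟩
    calc θ.effectiveEnergy p = (θ.restrict θ.support).effectiveEnergy p :=
          (θ.effectiveEnergy_restrict_support p).symm
      _ ≤ (θ.restrict (⋃ C ∈ s, U C)).effectiveEnergy p :=
          θ.effectiveEnergy_restrict_mono hS.measurableSet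
            (isClosed_biUnion_finset fun C _ => hU C).measurableSet hcover p
      _ ≤ ∑ C ∈ s, (θ.restrict (U C)).effectiveEnergy p :=
          θ.effectiveEnergy_restrict_biUnion_le s U hU hUc hUS p
      _ ≤ ∑ C ∈ s, if C.1 ∈ t then (θ.restrict C.1).effectiveEnergy p + ε else 0 :=
          Finset.sum_le_sum fun C _ => hq C
      _ = ∑ E ∈ s.image Subtype.val,
            if E ∈ t then (θ.restrict E).effectiveEnergy p + ε else 0 :=
          (Finset.sum_image (f := fun E => if E ∈ t then
            (θ.restrict E).effectiveEnergy p + ε else 0) Subtype.val_injective.injOn).symm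
      _ = ∑ E ∈ s.image Subtype.val with E ∈ t, ((θ.restrict E).effectiveEnergy p + ε) :=
          (Finset.sum_filter _ _).symm
      _ ≤ ∑ E ∈ t, ((θ.restrict E).effectiveEnergy p + ε) :=
          Finset.sum_le_sum_of_subset_of_nonneg (fun E hE => (Finset.mem_filter.1 hE).2)
            fun E _ _ => add_nonneg (hnn E) hε.le
  have hlim : Filter.Tendsto (fun ε : ℝ => ∑ E ∈ t, ((θ.restrict E).effectiveEnergy p + ε))
      (nhdsWithin 0 (Ioi 0)) (nhds (∑ E ∈ t, ((θ.restrict E).effectiveEnergy p + 0))) := by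
    have hc : Continuous fun ε : ℝ => ∑ E ∈ t, ((θ.restrict E).effectiveEnergy p + ε) := by
      fun_prop
    exact (hc.tendsto 0).mono_left nhdsWithin_le_nhds
  simp only [add_zero] at hlim
  exact ge_of_tendsto hlim (by filter_upwards [self_mem_nhdsWithin] with ε hε using key ε hε)

/-- A decomposition of the effective energies is a decomposition of the effective tensor. -/
theorem effectiveTensor_eq_sum (θ : Medium n) (t : Finset (Set (Torus n)))
    (h : ∀ p, θ.effectiveEnergy p = ∑ E ∈ t, (θ.restrict E).effectiveEnergy p) :
    θ.effectiveTensor = ∑ E ∈ t, (θ.restrict E).effectiveTensor := by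
  ext i j
  simp only [Matrix.sum_apply, effectiveTensor, Matrix.of_apply, h, ← Finset.sum_sub_distrib,
    Finset.sum_div]

end Medium

theorem theorem5p3 (n : ℕ) (θ : Medium n) (hθ : θ.Nontrivial)
    (hfin : μH[1] θ.support < ⊤) :
    ∃ 𝓔 : Set (Set (Torus n)), 𝓔.Countable ∧ 𝓔.PairwiseDisjoint id ∧
      (∀ E ∈ 𝓔, IsComponentOf E θ.support ∧ IsRectifiable 1 E) ∧
      HasSum (fun E : 𝓔 => (θ.restrict (E : Set (Torus n))).effectiveTensor)
        θ.effectiveTensor := by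
  have hS := θ.isClosed_support
  set 𝓔 : Set (Set (Torus n)) :=
    {E | IsComponentOf E θ.support ∧ ENNReal.ofReal (1 / 8) ≤ μH[1] E} with h𝓔
  have hfinite : 𝓔.Finite :=
    finite_setOf_isComponentOf_le_hausdorffMeasure hS hfin (by norm_num)
  have hdisj : 𝓔.PairwiseDisjoint id := fun E hE F hF hne => hE.1.disjoint hF.1 hne
  have hsum : ∀ p, θ.effectiveEnergy p =
      ∑ E ∈ hfinite.toFinset, (θ.restrict E).effectiveEnergy p := by
    intro p
    refine le_antisymm (θ.effectiveEnergy_le_sum _ (fun E hE hEt => ?_) p)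
      (θ.sum_effectiveEnergy_restrict_le _ (fun E hE => ?_) (by simpa using hdisj) p)
    · -- A component of length less than `1 / 8` lies in the ball around any of its points.
      obtain ⟨x, hx⟩ := hE.isConnected.nonempty
      refine ⟨x, fun y hy => ?_⟩
      by_contra hyx
      rw [Metric.mem_ball, not_lt] at hyx
      exact hEt (hfinite.mem_toFinset.2 ⟨hE,
        (hE.isConnected.isPreconnected.ofReal_le_hausdorffMeasure_inter_ball hx hy hyx).trans
          (measure_mono inter_subset_left)⟩)
    · exact ((hfinite.mem_toFinset.1 hE).1.isClosed hS).measurableSet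
  refine ⟨𝓔, hfinite.countable, hdisj, fun E hE => ⟨hE.1, ?_⟩, ?_⟩
  · exact IsRectifiable.of_isCompact_of_isConnected (hE.1.isClosed hS).isCompact hE.1.isConnected
      ((measure_mono hE.1.subset).trans_lt hfin)
  · rw [θ.effectiveTensor_eq_sum _ hsum]
    exact hfinite.subtypeEquivToFinset.hasSum_iff.2
      (hfinite.toFinset.hasSum fun E => (θ.restrict E).effectiveTensor)
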